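/- Let $d\ge 0$ be an integer and let $c_{ij},c_i,c_i',c_0\in L_\infty(\mathbf R^d)$ $(1\le i,j\le d)$ be complex-valued and $\mathbf Z^d$-periodic, i.e. $c_{ij}(x+n)=c_{ij}(x)$, etc., for all $n\in\mathbf Z^d$ and almost all $x\in\mathbf R^d$. Assume that $C=(c_{ij})$, which need not be symmetric, is uniformly elliptic: there is a $\lambda_0>0$ such that $\tfrac12(C(x)+C(x)^*)\ge\lambda_0 I$, in the sense of $d\times d$ matrices over $\mathbf C^d$, for almost all $x$. Write $\mathbf I=[0,1)$ and $\mathbf T=\{w\in\mathbf C:|w|=1\}$, and let $(\cdot,\cdot)$ be the inner product of $L_2(\mathbf I^d)$, linear in the second variable. For $z=(z_1,\dots,z_d)\in\mathbf T^d$ let $\partial_i^z$ be the skew-adjoint operator of differentiation in the $i$-th variable on $L_2(\mathbf I^d)$ with the $z$-periodic boundary condition $f(u_1,\dots,1,\dots,u_d)=z_i f(u_1,\dots,0,\dots,u_d)$ (the $1$ and $0$ in the $i$-th position); that is, $\partial_i^zf=g$ if and only if $(\varphi,g)=-(\partial_i\varphi,f)$ for all smooth $\varphi$ on $[0,1]^d$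 satisfying this boundary condition. Let $D(h_z)=\bigcap_{i=1}^d D(\partial_i^z)$ and, for $\varphi,f\in D(h_z)$, $$h_z(\varphi,f)=\sum_{i,j=1}^d(\partial_i^z\varphi,c_{ij}\partial_j^zf)+\sum_{i=1}^d\Big((\overline{c_i}\,\varphi,\partial_i^zf)+(\partial_i^z\varphi,c_i'f)\Big)+(\varphi,c_0f).$$ Let $H_z$ be the operator on $L_2(\mathbf I^d)$ associated with the sectorial form $h_z$: $f\in D(H_z)$ and $H_zf=g$ if and only if $f\in D(h_z)$ and $h_z(\varphi,f)=(\varphi,g)$ for all $\varphi\in D(h_z)$. Then for every $z\in\mathbf T^d$ the operator $H_z$ has compact resolvent: its resolvent set is non-empty and the resolvent of $H_z$ at every point of its resolvent set is a compact operator. Moreover, if $\mu\in\mathbf R$ is such that $\operatorname{Re}h_z(f,f)\ge-\mu\|f\|^2$ for all $f\in D(h_z)$, then for every $\lambda\in\mathbf C$ with $\operatorname{Re}\lambda>\mu$ the operator $\lambda I+H_z$ has a bounded everywhere defined inverse and $(\lambda I+H_z)^{-1}$ is compact. In particular, if $\operatorname{Re}h_z\ge0$, then $(\lambda I+H_z)^{-1}$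 exists and is compact for all $\lambda>0$. -/

import Mathlib

open MeasureTheory
open scoped ContDiff ComplexConjugate

namespace PeriodicElliptic

noncomputable section

/-- The half-open unit cube `[0,1)^d`. -/
def cube (d : ℕ) : Set (Fin d → ℝ) := Set.univ.pi fun _ => Set.Ico 0 1

/-- Lebesgue measure on the unit cube. -/
def cubeMeasure (d : ℕ) : Measure (Fin d → ℝ) := volume.restrict (cube d)

/-- The complex Hilbert space `L₂([0,1)^d)`. -/
abbrev L2Cube (d : ℕ) : Type := Lp ℂ 2 (cubeMeasure d)

/-- The pairing `(f, g) = ∫ conj f * g` over the unit cube, linear in the second variable. -/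
def pairing {d : ℕ} (f g : (Fin d → ℝ) → ℂ) : ℂ :=
  ∫ u, conj (f u) * g u ∂(cubeMeasure d)

/-- The classical partial derivative `∂φ/∂x_i`. -/
def classicalPartial {d : ℕ} (i : Fin d) (φ : (Fin d → ℝ) → ℂ) (x : Fin d → ℝ) : ℂ :=
  fderiv ℝ φ x (Pi.single i 1)

/-- Smooth functions satisfying the `z`-periodic boundary condition in the `i`-th direction on the
closed unit cube: `φ(u₁,…,1,…,u_d) = z_i φ(u₁,…,0,…,u_d)`, the `1` and `0` in the `i`-th place. -/
structure IsTest {d : ℕ} (z : Fin d → Circle) (i : Fin d) (φ : (Fin d → ℝ) → ℂ) : Prop where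
  smooth : ContDiff ℝ ∞ φ
  boundary : ∀ u ∈ Set.Icc (0 : Fin d → ℝ) 1,
    φ (Function.update u i 1) = (z i : ℂ) * φ (Function.update u i 0)

/-! ### Integrability facts needed by the definitions -/

instance (d : ℕ) : IsFiniteMeasure (cubeMeasure d) := by
  constructor
  rw [cubeMeasure, Measure.restrict_apply_univ]
  refine lt_of_le_of_lt (measure_mono (t := Set.Icc (0 : Fin d → ℝ) 1) ?_)
    isCompact_Icc.measure_lt_top
  intro u hu
  simp only [cube, Set.mem_univ_pi, Set.mem_Ico] at hu
  exact ⟨fun i => (hu i).1, fun i => (hu i).2.le⟩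

lemma cube_subset (d : ℕ) : cube d ⊆ Set.Icc (0 : Fin d → ℝ) 1 := by
  intro u hu
  simp only [cube, Set.mem_univ_pi, Set.mem_Ico] at hu
  exact ⟨fun i => (hu i).1, fun i => (hu i).2.le⟩

lemma measurableSet_cube (d : ℕ) : MeasurableSet (cube d) :=
  MeasurableSet.univ_pi fun _ => measurableSet_Ico

lemma memLp_of_continuous {d : ℕ} {φ : (Fin d → ℝ) → ℂ} (h : Continuous φ) :
    MemLp φ 2 (cubeMeasure d) := by
  obtain ⟨C, hC⟩ := isCompact_Icc.exists_bound_of_continuousOn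
    (s := Set.Icc (0 : Fin d → ℝ) 1) h.continuousOn
  refine MemLp.of_bound h.aestronglyMeasurable C ?_
  exact (ae_restrict_iff' (measurableSet_cube d)).2
    (Filter.Eventually.of_forall fun u hu => hC u (cube_subset d hu))

lemma integrable_conj_mul {d : ℕ} {f g : (Fin d → ℝ) → ℂ} (hf : MemLp f 2 (cubeMeasure d))
    (hg : MemLp g 2 (cubeMeasure d)) :
    Integrable (fun u => conj (f u) * g u) (cubeMeasure d) := by
  have : MemLp (fun u => conj (f u)) 2 (cubeMeasure d) := hf.star
  exact this.integrable_mul hg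

lemma pairing_add {d : ℕ} {f g₁ g₂ : (Fin d → ℝ) → ℂ} (hf : MemLp f 2 (cubeMeasure d))
    (h₁ : MemLp g₁ 2 (cubeMeasure d)) (h₂ : MemLp g₂ 2 (cubeMeasure d)) :
    pairing f (g₁ + g₂) = pairing f g₁ + pairing f g₂ := by
  rw [pairing, pairing, pairing,
    ← integral_add (integrable_conj_mul hf h₁) (integrable_conj_mul hf h₂)]
  simp [mul_add]

lemma pairing_smul {d : ℕ} (c : ℂ) (f g : (Fin d → ℝ) → ℂ) :
    pairing f (c • g) = c * pairing f g := by
  rw [pairing, pairing, ← integral_const_mul]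
  congr 1
  ext u
  simp
  ring

lemma pairing_congr {d : ℕ} {f f' g g' : (Fin d → ℝ) → ℂ} (hf : f =ᵐ[cubeMeasure d] f')
    (hg : g =ᵐ[cubeMeasure d] g') : pairing f g = pairing f' g' := by
  apply integral_congr_ae
  filter_upwards [hf, hg] with u h1 h2
  rw [h1, h2]

lemma IsTest.memLp {d : ℕ} {z : Fin d → Circle} {i : Fin d} {φ : (Fin d → ℝ) → ℂ}
    (h : IsTest z i φ) : MemLp φ 2 (cubeMeasure d) :=
  memLp_of_continuous h.smooth.continuous

lemma continuous_classicalPartial {d : ℕ} {i : Fin d} {φ : (Fin d → ℝ) → ℂ}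
    (h : ContDiff ℝ ∞ φ) : Continuous (classicalPartial i φ) :=
  (h.continuous_fderiv (by simp)).clm_apply continuous_const

/-! ### The operators `∂_i^z` -/

/-- The graph of `∂_i^z`: the pairs `(f, g)` in `L₂([0,1)^d)` with `(φ, g) = -(∂_i φ, f)` for every
smooth `φ` with the `z`-periodic boundary condition.  Thus `∂_i^z` is minus the adjoint of `∂_i`
on those functions, i.e. the skew-adjoint realization of `∂_i` with that boundary condition. -/
def partialGraph {d : ℕ} (z : Fin d → Circle) (i : Fin d) :
    Submodule ℂ (L2Cube d × L2Cube d) where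
  carrier := {p | ∀ φ, IsTest z i φ →
    pairing φ (p.2 : L2Cube d) = -pairing (classicalPartial i φ) (p.1 : L2Cube d)}
  add_mem' := by
    intro p q hp hq φ hφ
    have hd := memLp_of_continuous (continuous_classicalPartial (i := i) hφ.smooth)
    rw [Prod.snd_add, Prod.fst_add, pairing_congr (Filter.EventuallyEq.refl _ _) (Lp.coeFn_add _ _),
      pairing_congr (f := classicalPartial i φ) (Filter.EventuallyEq.refl _ _) (Lp.coeFn_add _ _),
      pairing_add hφ.memLp (Lp.memLp _) (Lp.memLp _), pairing_add hd (Lp.memLp _) (Lp.memLp _),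
      hp φ hφ, hq φ hφ]
    ring
  zero_mem' := by
    intro φ _
    rw [Prod.snd_zero, Prod.fst_zero,
      pairing_congr (g' := 0) (Filter.EventuallyEq.refl _ _) (Lp.coeFn_zero _ _ _),
      pairing_congr (f := classicalPartial i φ) (g' := 0) (Filter.EventuallyEq.refl _ _)
        (Lp.coeFn_zero _ _ _)]
    simp [pairing]
  smul_mem' := by
    intro c p hp φ hφ
    rw [Prod.smul_snd, Prod.smul_fst,
      pairing_congr (Filter.EventuallyEq.refl _ _) (Lp.coeFn_smul _ _),
      pairing_congr (f := classicalPartial i φ) (Filter.EventuallyEq.refl _ _) (Lp.coeFn_smul _ _),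
      pairing_smul, pairing_smul, hp φ hφ]
    ring

/-- The operator `∂_i^z` on `L₂([0,1)^d)`. -/
def partialZ {d : ℕ} (z : Fin d → Circle) (i : Fin d) : L2Cube d →ₗ.[ℂ] L2Cube d :=
  (partialGraph z i).toLinearPMap

/-- The open unit cube. -/
def openCube (d : ℕ) : Set (Fin d → ℝ) := Set.univ.pi fun _ => Set.Ioo 0 1

lemma openCube_ae_eq (d : ℕ) : openCube d =ᵐ[volume] cube d :=
  (Measure.univ_pi_Ioo_ae_eq_Icc (μ := fun _ : Fin d => (volume : Measure ℝ))
    (f := fun _ => 0) (g := fun _ => 1)).trans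
  (Measure.univ_pi_Ico_ae_eq_Icc (μ := fun _ : Fin d => (volume : Measure ℝ))
    (f := fun _ => 0) (g := fun _ => 1)).symm

lemma cubeMeasure_eq (d : ℕ) : cubeMeasure d = volume.restrict (openCube d) :=
  (Measure.restrict_congr_set (openCube_ae_eq d)).symm

lemma ae_eq_zero_of_pairing {d : ℕ} {g : (Fin d → ℝ) → ℂ} (hg : MemLp g 2 (cubeMeasure d))
    (h : ∀ φ : (Fin d → ℝ) → ℝ, ContDiff ℝ ∞ φ → HasCompactSupport φ → tsupport φ ⊆ openCube d →
      pairing (fun u => (φ u : ℂ)) g = 0) : g =ᵐ[cubeMeasure d] 0 := by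
  have hopen : IsOpen (openCube d) := isOpen_set_pi Set.finite_univ fun _ _ => isOpen_Ioo
  have hint : IntegrableOn g (openCube d) volume := by
    rw [IntegrableOn, ← cubeMeasure_eq]
    exact hg.integrable (by norm_num)
  have key := hopen.ae_eq_zero_of_integral_contDiff_smul_eq_zero (μ := volume)
    hint.locallyIntegrableOn (f := g) (by
      intro φ h1 h2 h3
      have := h φ h1 h2 h3
      rw [pairing, cubeMeasure_eq, setIntegral_eq_integral_of_forall_compl_eq_zero] at this
      · simpa using this
      · intro x hx
        have : φ x = 0 := image_eq_zero_of_notMem_tsupport fun hx' => hx (h3 hx')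
        simp [this])
  rw [cubeMeasure_eq]
  exact (ae_restrict_iff' hopen.measurableSet).2 key

/-- An `L₂` function orthogonal to all smooth functions supported in the open cube vanishes. -/
lemma eq_zero_of_pairing {d : ℕ} (g : L2Cube d)
    (h : ∀ φ : (Fin d → ℝ) → ℝ, ContDiff ℝ ∞ φ → HasCompactSupport φ → tsupport φ ⊆ openCube d →
      pairing (fun u => (φ u : ℂ)) g = 0) : g = 0 :=
  (Lp.eq_zero_iff_ae_eq_zero).2 (ae_eq_zero_of_pairing (Lp.memLp g) h)

/-- A smooth function supported in the open cube satisfies every boundary condition. -/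
lemma isTest_of_tsupport {d : ℕ} (z : Fin d → Circle) (i : Fin d) {φ : (Fin d → ℝ) → ℝ}
    (h1 : ContDiff ℝ ∞ φ) (h3 : tsupport φ ⊆ openCube d) :
    IsTest z i (fun u => (φ u : ℂ)) := by
  refine ⟨Complex.ofRealCLM.contDiff.comp h1, fun u _ => ?_⟩
  have hz : ∀ x : Fin d → ℝ, (x i = 0 ∨ x i = 1) → φ x = 0 := by
    intro x hx
    refine image_eq_zero_of_notMem_tsupport fun hx' => ?_
    have := h3 hx' i (Set.mem_univ i)
    simp only [Set.mem_Ioo] at this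
    rcases hx with hx | hx <;> rw [hx] at this <;> linarith [this.1, this.2]
  rw [hz _ (Or.inr (by simp)), hz _ (Or.inl (by simp))]
  simp

lemma partialGraph_unique {d : ℕ} (z : Fin d → Circle) (i : Fin d) :
    ∀ p ∈ partialGraph z i, p.1 = 0 → p.2 = 0 := by
  intro p hp h0
  refine eq_zero_of_pairing p.2 fun φ h1 h2 h3 => ?_
  rw [hp _ (isTest_of_tsupport z i h1 h3), h0,
    pairing_congr (g' := 0) (Filter.EventuallyEq.refl _ _) (Lp.coeFn_zero _ _ _)]
  simp [pairing]

lemma partialZ_graph {d : ℕ} (z : Fin d → Circle) (i : Fin d) :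
    (partialZ z i).graph = partialGraph z i :=
  Submodule.toLinearPMap_graph_eq _ fun p hp h0 => partialGraph_unique z i p hp h0

/-! ### The form `h_z` -/

/-- The form domain `D(h_z) = ⋂ᵢ D(∂_i^z)`. -/
def formDomain {d : ℕ} (z : Fin d → Circle) : Submodule ℂ (L2Cube d) :=
  ⨅ i, (partialZ z i).domain

/-- The map `f ↦ ∂_i^z f` on the form domain. -/
def gradZ {d : ℕ} (z : Fin d → Circle) (i : Fin d) : formDomain z →ₗ[ℂ] L2Cube d :=
  (partialZ z i).toFun ∘ₗ Submodule.inclusion (iInf_le _ i)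

/-- The coefficients of a second-order elliptic operator in divergence form on `ℝ^d`: complex,
bounded and measurable, `ℤ^d`-periodic and uniformly elliptic.  As elements of `L_∞(ℝ^d)` they
matter only up to null sets. -/
structure Coefficients (d : ℕ) where
  /-- the principal coefficients `c_{ij}` -/
  C : (Fin d → ℝ) → Matrix (Fin d) (Fin d) ℂ
  /-- the first-order coefficients `c_i` -/
  c : Fin d → (Fin d → ℝ) → ℂ
  /-- the first-order coefficients `c'_i` -/
  c' : Fin d → (Fin d → ℝ) → ℂ
  /-- the zero-order coefficient -/
  c₀ : (Fin d → ℝ) → ℂ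
  memLp_C : ∀ i j, MemLp (fun x => C x i j) ⊤ volume
  memLp_c : ∀ i, MemLp (c i) ⊤ volume
  memLp_c' : ∀ i, MemLp (c' i) ⊤ volume
  memLp_c₀ : MemLp c₀ ⊤ volume
  periodic_C : ∀ n : Fin d → ℤ, ∀ᵐ x, C (x + fun k => (n k : ℝ)) = C x
  periodic_c : ∀ i, ∀ n : Fin d → ℤ, ∀ᵐ x, c i (x + fun k => (n k : ℝ)) = c i x
  periodic_c' : ∀ i, ∀ n : Fin d → ℤ, ∀ᵐ x, c' i (x + fun k => (n k : ℝ)) = c' i x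
  periodic_c₀ : ∀ n : Fin d → ℤ, ∀ᵐ x, c₀ (x + fun k => (n k : ℝ)) = c₀ x
  /-- `(C + C*)/2 ≥ lam I > 0` as quadratic forms on `ℂ^d`, uniformly in `x` -/
  elliptic : ∃ lam : ℝ, 0 < lam ∧ ∀ᵐ x, ∀ ξ : Fin d → ℂ,
    lam * ∑ i, ‖ξ i‖ ^ 2 ≤ (∑ i, ∑ j, conj (ξ i) * C x i j * ξ j).re

variable {d : ℕ}

/-- The sesquilinear form
`h_z(φ,f) = ∑ (∂_i φ, c_{ij} ∂_j f) + ∑ ((conj c_i φ, ∂_i f) + (∂_i φ, c'_i f)) + (φ, c₀ f)`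
on `D(h_z)`, where `∂_i` is `∂_i^z`. -/
def Coefficients.form (a : Coefficients d) (z : Fin d → Circle) (φ f : formDomain z) : ℂ :=
  ∑ i, ∑ j, pairing (gradZ z i φ) (fun u => a.C u i j * gradZ z j f u)
  + ∑ i, (pairing (fun u => conj (a.c i u) * (φ : L2Cube d) u) (gradZ z i f)
      + pairing (gradZ z i φ) (fun u => a.c' i u * (f : L2Cube d) u))
  + pairing (φ : L2Cube d) (fun u => a.c₀ u * (f : L2Cube d) u)

lemma memLp_mul {b : (Fin d → ℝ) → ℂ} (hb : MemLp b ⊤ volume) (f : L2Cube d) :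
    MemLp (fun u => b u * f u) 2 (cubeMeasure d) :=
  (Lp.memLp f).mul' (hb.restrict (cube d))

lemma pairing_mul_add {b : (Fin d → ℝ) → ℂ} (hb : MemLp b ⊤ volume) {k : (Fin d → ℝ) → ℂ}
    (hk : MemLp k 2 (cubeMeasure d)) (f g : L2Cube d) :
    pairing k (fun u => b u * (f + g : L2Cube d) u)
      = pairing k (fun u => b u * f u) + pairing k (fun u => b u * g u) := by
  rw [← pairing_add hk (memLp_mul hb f) (memLp_mul hb g)]
  refine pairing_congr (Filter.EventuallyEq.refl _ _) ?_
  filter_upwards [Lp.coeFn_add f g] with u hu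
  simp only [hu, Pi.add_apply, mul_add]

lemma pairing_mul_smul (b k : (Fin d → ℝ) → ℂ) (r : ℂ) (f : L2Cube d) :
    pairing k (fun u => b u * (r • f : L2Cube d) u) = r * pairing k (fun u => b u * f u) := by
  rw [← pairing_smul]
  refine pairing_congr (Filter.EventuallyEq.refl _ _) ?_
  filter_upwards [Lp.coeFn_smul r f] with u hu
  simp only [hu, Pi.smul_apply, smul_eq_mul]
  ring

lemma memLp_conj {b : (Fin d → ℝ) → ℂ} (hb : MemLp b ⊤ volume) :
    MemLp (fun u => conj (b u)) ⊤ volume := hb.star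

lemma Coefficients.form_add (a : Coefficients d) (z : Fin d → Circle) (φ f g : formDomain z) :
    a.form z φ (f + g) = a.form z φ f + a.form z φ g := by
  have h2 : ∀ i, pairing (fun u => conj (a.c i u) * (φ : L2Cube d) u) (gradZ z i f + gradZ z i g :
      L2Cube d) = pairing (fun u => conj (a.c i u) * (φ : L2Cube d) u) (gradZ z i f)
        + pairing (fun u => conj (a.c i u) * (φ : L2Cube d) u) (gradZ z i g) := fun i => by
    rw [← pairing_add (memLp_mul (memLp_conj (a.memLp_c i)) _) (Lp.memLp _) (Lp.memLp _)]
    exact pairing_congr (Filter.EventuallyEq.refl _ _) (Lp.coeFn_add _ _)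
  simp only [Coefficients.form, map_add, Submodule.coe_add, h2,
    pairing_mul_add (a.memLp_C _ _) (Lp.memLp _), pairing_mul_add (a.memLp_c' _) (Lp.memLp _),
    pairing_mul_add a.memLp_c₀ (Lp.memLp _), Finset.sum_add_distrib]
  ring

lemma Coefficients.form_smul (a : Coefficients d) (z : Fin d → Circle) (r : ℂ)
    (φ f : formDomain z) : a.form z φ (r • f) = r * a.form z φ f := by
  have h2 : ∀ i, pairing (fun u => conj (a.c i u) * (φ : L2Cube d) u) (r • gradZ z i f :
      L2Cube d) = r * pairing (fun u => conj (a.c i u) * (φ : L2Cube d) u) (gradZ z i f) :=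
    fun i => by
    rw [← pairing_smul]
    exact pairing_congr (Filter.EventuallyEq.refl _ _) (Lp.coeFn_smul _ _)
  simp only [Coefficients.form, map_smul, Submodule.coe_smul, h2, pairing_mul_smul,
    Finset.mul_sum, mul_add]

/-! ### The operator `H_z` -/

/-- The graph of the operator associated with `h_z`: `f ∈ D(H_z)` and `H_z f = g` if and only if
`f ∈ D(h_z)` and `h_z(φ, f) = (φ, g)` for all `φ ∈ D(h_z)`. -/
def Coefficients.operatorGraph (a : Coefficients d) (z : Fin d → Circle) :
    Submodule ℂ (L2Cube d × L2Cube d) where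
  carrier := {p | ∃ hf : p.1 ∈ formDomain z, ∀ φ : formDomain z,
    a.form z φ ⟨p.1, hf⟩ = inner ℂ (φ : L2Cube d) p.2}
  add_mem' := by
    rintro p q ⟨hp, hp'⟩ ⟨hq, hq'⟩
    refine ⟨add_mem hp hq, fun φ => ?_⟩
    rw [Prod.snd_add, inner_add_right, ← hp' φ, ← hq' φ, ← a.form_add]
    rfl
  zero_mem' := by
    refine ⟨zero_mem _, fun φ => ?_⟩
    have := a.form_smul z 0 φ 0
    rw [zero_smul, zero_mul] at this
    rw [Prod.snd_zero, inner_zero_right]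
    exact this
  smul_mem' := by
    rintro r p ⟨hp, hp'⟩
    refine ⟨Submodule.smul_mem _ r hp, fun φ => ?_⟩
    rw [Prod.smul_snd, inner_smul_right, ← hp' φ, ← a.form_smul]
    rfl

/-- The operator `H_z` on `L₂([0,1)^d)` associated with the sectorial form `h_z`. -/
def Coefficients.operator (a : Coefficients d) (z : Fin d → Circle) :
    L2Cube d →ₗ.[ℂ] L2Cube d :=
  (a.operatorGraph z).toLinearPMap

/-- Integration by parts against a smooth function supported in the open cube. -/
lemma pairing_classicalPartial (i : Fin d) {φ : (Fin d → ℝ) → ℂ} (hφ : ContDiff ℝ ∞ φ)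
    {ψ : (Fin d → ℝ) → ℝ} (h1 : ContDiff ℝ ∞ ψ) (h2 : HasCompactSupport ψ)
    (h3 : tsupport ψ ⊆ openCube d) :
    pairing φ (classicalPartial i fun u => (ψ u : ℂ))
      = -pairing (classicalPartial i φ) (fun u => (ψ u : ℂ)) := by
  set Ψ : (Fin d → ℝ) → ℂ := fun u => (ψ u : ℂ) with hΨ
  have hΨs : ContDiff ℝ ∞ Ψ := Complex.ofRealCLM.contDiff.comp h1
  have hΨc : HasCompactSupport Ψ := h2.comp_left (g := Complex.ofReal) (by simp)
  have hsub : tsupport Ψ ⊆ openCube d :=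
    (closure_mono fun x hx => by
      simp only [Function.mem_support, hΨ, ne_eq, Complex.ofReal_eq_zero] at hx ⊢
      exact hx).trans h3
  have hΨ'c : HasCompactSupport (classicalPartial i Ψ) :=
    (hΨc.fderiv ℝ).comp_left (g := fun L : (Fin d → ℝ) →L[ℝ] ℂ => L (Pi.single i 1)) (by simp)
  have hmeas : cubeMeasure d = volume.restrict (openCube d) :=
    (Measure.restrict_congr_set (openCube_ae_eq d)).symm
  have hφ' : ContDiff ℝ ∞ (fun u => conj (φ u)) := Complex.conjCLE.contDiff.comp hφ
  have hconj : ∀ x, fderiv ℝ (fun u => conj (φ u)) x (Pi.single i 1)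
      = conj (classicalPartial i φ x) := by
    intro x
    have hd : HasFDerivAt φ (fderiv ℝ φ x) x :=
      (hφ.differentiable (by simp) x).hasFDerivAt
    have := (Complex.conjCLE.toContinuousLinearMap.hasFDerivAt (x := φ x)).comp x hd
    have h' := this.fderiv
    simp only [Function.comp_def] at h'
    exact congrArg (fun L : (Fin d → ℝ) →L[ℝ] ℂ => L (Pi.single i 1)) h'
  have hIBP := integral_mul_fderiv_eq_neg_fderiv_mul_of_integrable
    (μ := (volume : Measure (Fin d → ℝ))) (f := fun u => conj (φ u)) (g := Ψ)
    (v := Pi.single i 1)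
    (Continuous.integrable_of_hasCompactSupport
      ((continuous_classicalPartial hφ').mul hΨs.continuous) hΨc.mul_left)
    (Continuous.integrable_of_hasCompactSupport
      (hφ'.continuous.mul (continuous_classicalPartial hΨs)) hΨ'c.mul_left)
    (Continuous.integrable_of_hasCompactSupport
      (hφ'.continuous.mul hΨs.continuous) hΨc.mul_left)
    (fun x _ => hφ'.differentiable (by simp) x)
    (fun x _ => hΨs.differentiable (by simp) x)
  simp only [hconj] at hIBP
  rw [pairing, pairing, hmeas, setIntegral_eq_integral_of_forall_compl_eq_zero,
    setIntegral_eq_integral_of_forall_compl_eq_zero]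
  · exact hIBP
  · intro x hx
    have : Ψ x = 0 := image_eq_zero_of_notMem_tsupport fun hx' => hx (hsub hx')
    simp [this]
  · intro x hx
    have : fderiv ℝ Ψ x = 0 := image_eq_zero_of_notMem_tsupport fun hx' =>
      hx (hsub (tsupport_fderiv_subset ℝ hx'))
    simp [classicalPartial, this]

/-- The form domain contains the smooth functions supported in the open cube (so it is dense). -/
lemma mem_formDomain_of_tsupport (z : Fin d → Circle) {ψ : (Fin d → ℝ) → ℝ}
    (h1 : ContDiff ℝ ∞ ψ) (h2 : HasCompactSupport ψ) (h3 : tsupport ψ ⊆ openCube d)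
    (hψ : MemLp (fun u => (ψ u : ℂ)) 2 (cubeMeasure d)) : hψ.toLp ∈ formDomain z := by
  rw [formDomain, Submodule.mem_iInf]
  intro i
  have hΨs : ContDiff ℝ ∞ (fun u => (ψ u : ℂ)) := Complex.ofRealCLM.contDiff.comp h1
  have hd := memLp_of_continuous (continuous_classicalPartial (i := i) hΨs)
  have : (hψ.toLp, hd.toLp) ∈ partialGraph z i := by
    intro φ hφ
    rw [pairing_congr (Filter.EventuallyEq.refl _ _) hd.coeFn_toLp,
      pairing_congr (f := classicalPartial i φ) (Filter.EventuallyEq.refl _ _) hψ.coeFn_toLp]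
    exact pairing_classicalPartial i hφ.smooth h1 h2 h3
  rw [← partialZ_graph] at this
  exact LinearPMap.mem_domain_of_mem_graph this

lemma Coefficients.operatorGraph_unique (a : Coefficients d) (z : Fin d → Circle) :
    ∀ p ∈ a.operatorGraph z, p.1 = 0 → p.2 = 0 := by
  rintro ⟨f, g⟩ ⟨hf, hfg⟩ h0
  simp only at h0 hf hfg ⊢
  subst h0
  have h : ∀ φ : formDomain z, inner ℂ (φ : L2Cube d) g = 0 := by
    intro φ
    rw [← hfg φ]
    have := a.form_smul z 0 φ 0
    rw [zero_smul, zero_mul] at this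
    exact this
  refine eq_zero_of_pairing g fun ψ h1 h2 h3 => ?_
  have hψ : MemLp (fun u => (ψ u : ℂ)) 2 (cubeMeasure d) :=
    memLp_of_continuous (Complex.continuous_ofReal.comp h1.continuous)
  have := h ⟨_, mem_formDomain_of_tsupport z h1 h2 h3 hψ⟩
  rw [L2.inner_def] at this
  rw [← this]
  apply integral_congr_ae
  filter_upwards [hψ.coeFn_toLp] with u hu
  simp [hu, mul_comm]

lemma Coefficients.operator_graph (a : Coefficients d) (z : Fin d → Circle) :
    (a.operator z).graph = a.operatorGraph z :=
  Submodule.toLinearPMap_graph_eq _ fun p hp h0 => a.operatorGraph_unique z p hp h0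

end

/-! ### Compact resolvent -/

/-- `R` is the bounded inverse `(lam I + T)⁻¹`, i.e. the resolvent of `T` at the point `-lam`. -/
def IsResolvent {E : Type*} [NormedAddCommGroup E] [NormedSpace ℂ E] (T : E →ₗ.[ℂ] E) (lam : ℂ)
    (R : E →L[ℂ] E) : Prop :=
  (∀ g : E, ∃ h : R g ∈ T.domain, lam • R g + T ⟨R g, h⟩ = g) ∧
    ∀ f : T.domain, R (lam • (f : E) + T f) = f

/-- The operator `T` has compact resolvent: its resolvent set is not empty and the resolvent is a
compact operator at every point of the resolvent set. -/
def HasCompactResolvent {E : Type*} [NormedAddCommGroup E] [NormedSpace ℂ E]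
    (T : E →ₗ.[ℂ] E) : Prop :=
  (∃ (lam : ℂ) (R : E →L[ℂ] E), IsResolvent T lam R) ∧
    ∀ (lam : ℂ) (R : E →L[ℂ] E), IsResolvent T lam R → IsCompactOperator R

end PeriodicElliptic

/-!
The form domain `D(h_z)` with its graph norm is a Hilbert space, because the operators `∂_i^z` are
closed; it is realized as `sobolevSpace z`, a closed subspace of a finite power of `L₂`. The proof
rests on two facts about it.

* Its inclusion into `L₂` is compact (`isCompactOperator_sobolevValue`). The Bloch waves
  `exp (i (θ + 2πn) · u)`, `n ∈ ℤ^d`, where `z_j = exp (iθ_j)`, form a Hilbert basis of `L₂` by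
  comparison with the Fourier basis of the torus (`blochBasis`). They satisfy the `z`-periodic
  boundary conditions, so the definition of `∂_i^z` by duality says that `∂_i^z` multiplies the
  `n`-th coefficient by `i (θ_i + 2πn_i)` (`inner_blochBasis_of_mem_partialGraph`). Hence the graph
  norm controls the coefficients with a weight tending to infinity, and the inclusion is a norm
  limit of operators of finite rank (`isCompactOperator_of_weighted_coeff`).
* The form satisfies Gårding's inequality (`Coefficients.exists_le_re_form`): ellipticity absorbs
  the first-order terms. Combined with a lower bound `Re h_z ≥ -μ`, it makes `λ + h_z` coercive on
  the form domain for every `λ` with `Re λ > μ` (`Coefficients.exists_coercive`).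

By Lax–Milgram the bounded operator `B` representing `λ + h_z` on the form domain is invertible, and
with `J` the inclusion into `L₂` the resolvent is `(λ + H_z)⁻¹ = J B⁻¹ J*`, compact because `J` is.
Gårding's inequality itself provides some lower bound of the form, so the resolvent set is not
empty, and the resolvent identity carries compactness to all its other points
(`IsResolvent.isCompactOperator`).
-/

/-! ### Two facts about operators on Hilbert spaces -/

/-- The Lax–Milgram lemma over `ℝ` or `ℂ`: a bounded operator whose quadratic form is coercive is
bijective, since it is bounded below and nothing is orthogonal to its range. -/
theorem ContinuousLinearMap.bijective_of_coercive {𝕜 V : Type*} [RCLike 𝕜] [NormedAddCommGroup V]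
    [InnerProductSpace 𝕜 V] [CompleteSpace V] (A : V →L[𝕜] V) {c : ℝ} (hc : 0 < c)
    (hA : ∀ v, c * ‖v‖ ^ 2 ≤ RCLike.re (inner 𝕜 v (A v))) : Function.Bijective A := by
  have hbound : ∀ v, c * ‖v‖ ≤ ‖A v‖ := by
    intro v
    rcases (norm_nonneg v).eq_or_lt with h | h
    · rw [← h]; simp
    · have h1 : c * ‖v‖ ^ 2 ≤ ‖v‖ * ‖A v‖ :=
        (hA v).trans ((RCLike.re_le_norm _).trans (norm_inner_le_norm _ _))
      nlinarith
  have hanti : AntilipschitzWith (c⁻¹).toNNReal A := by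
    refine A.antilipschitz_of_bound fun v => ?_
    rw [Real.coe_toNNReal _ (inv_nonneg.2 hc.le), ← div_eq_inv_mul, le_div_iff₀ hc, mul_comm]
    exact hbound v
  refine ⟨hanti.injective, ?_⟩
  have hclosed := hanti.isClosed_range A.uniformContinuous
  have : CompleteSpace A.range := hclosed.completeSpace_coe
  refine LinearMap.range_eq_top.1 ?_
  rw [← A.range.orthogonal_orthogonal, Submodule.eq_top_iff']
  intro v w hw
  have h0 : inner 𝕜 w (A w) = 0 :=
    Submodule.inner_left_of_mem_orthogonal (K := A.range) ⟨w, rfl⟩ hw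
  have h1 := hA w
  rw [h0, map_zero] at h1
  have : ‖w‖ ^ 2 = 0 := le_antisymm (by nlinarith) (sq_nonneg _)
  obtain rfl : w = 0 := by simpa using this
  exact inner_zero_left _

/-- A bounded operator into a Hilbert space is compact if the coefficients of its values in some
Hilbert basis are square summable against a weight tending to infinity: it is then a norm limit of
its finite sections. -/
theorem isCompactOperator_of_weighted_coeff {𝕜 V H ι : Type*} [RCLike 𝕜] [NormedAddCommGroup V]
    [NormedSpace 𝕜 V] [NormedAddCommGroup H] [InnerProductSpace 𝕜 H] [CompleteSpace H]
    (b : HilbertBasis ι 𝕜 H) (T : V →L[𝕜] H) (w : ι → ℝ) (hw : ∀ M, {n | w n ≤ M}.Finite)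
    (hT : ∀ v, ∀ s : Finset ι, ∑ n ∈ s, w n * ‖inner 𝕜 (b n) (T v)‖ ^ 2 ≤ ‖v‖ ^ 2)
    (hw0 : ∀ n, 0 ≤ w n) :
    IsCompactOperator T := by
  classical
  have hmem : T ∈ closure {F : V →L[𝕜] H | IsCompactOperator F} := by
    refine Metric.mem_closure_iff.2 fun ε hε => ?_
    set M : ℝ := (2 / ε) ^ 2 with hM
    have hMpos : 0 < M := by positivity
    set S : Finset ι := (hw M).toFinset with hS
    set P : H →L[𝕜] H := ∑ n ∈ S, (innerSL 𝕜 (b n)).smulRight (b n) with hP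
    refine ⟨P ∘L T, ?_, ?_⟩
    · have hPc : P ∈ compactOperator (RingHom.id 𝕜) H H := by
        refine Submodule.sum_mem _ fun n _ => ?_
        have h1 : IsCompactOperator (ContinuousLinearMap.toSpanSingleton 𝕜 (b n)) :=
          isCompactOperator_id.clm_comp (ContinuousLinearMap.toSpanSingleton 𝕜 (b n))
        exact h1.comp_clm (innerSL 𝕜 (b n))
      exact IsCompactOperator.comp_clm hPc T
    · have hcoef : ∀ x m, inner 𝕜 (b m) (x - P x) = if m ∈ S then 0 else inner 𝕜 (b m) x := by
        intro x m
        have : inner 𝕜 (b m) (P x) = if m ∈ S then inner 𝕜 (b m) x else 0 := by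
          simp only [hP, sum_apply, ContinuousLinearMap.smulRight_apply,
            innerSL_apply_apply, inner_sum, inner_smul_right,
            orthonormal_iff_ite.1 b.orthonormal, mul_ite, mul_one, mul_zero,
            Finset.sum_ite_eq]
        rw [inner_sub_right, this]
        split_ifs <;> simp
      have hle : ‖T - P ∘L T‖ ≤ ε / 2 := by
        refine ContinuousLinearMap.opNorm_le_bound _ (by positivity) fun v => ?_
        have hsum : HasSum (fun n => ‖inner 𝕜 (b n) (T v - P (T v))‖ ^ 2)
            (‖T v - P (T v)‖ ^ 2) := by
          have h := RCLike.hasSum_re 𝕜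
            (b.hasSum_inner_mul_inner (T v - P (T v)) (T v - P (T v)))
          rw [inner_self_eq_norm_sq] at h
          refine h.congr_fun ?_
          intro n
          rw [← inner_conj_symm (T v - P (T v)) (b n), RCLike.conj_mul, ← RCLike.ofReal_pow,
            RCLike.ofReal_re]
        have h2 : ‖T v - P (T v)‖ ^ 2 ≤ ‖v‖ ^ 2 / M := by
          refine hasSum_le_of_sum_le hsum fun s => ?_
          rw [le_div_iff₀ hMpos, Finset.sum_mul]
          refine (Finset.sum_le_sum fun n _ => ?_).trans (hT v s)
          rw [hcoef]
          split_ifs with h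
          · simpa using mul_nonneg (hw0 n) (sq_nonneg _)
          · rw [mul_comm]
            have : M ≤ w n := by
              by_contra hlt
              exact h (by simpa [hS] using (not_le.1 hlt).le)
            gcongr
        have h3 : ‖v‖ ^ 2 / M = (ε / 2 * ‖v‖) ^ 2 := by
          rw [hM]; field_simp
        rw [h3] at h2
        exact abs_le_of_sq_le_sq' h2 (by positivity) |>.2
      rw [dist_eq_norm]
      linarith
  rwa [isClosed_setOfPred_isCompactOperator.closure_eq] at hmem

/-! ### The Fourier basis with quasi-periodic boundary conditions -/

namespace PeriodicElliptic

noncomputable section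

variable {d : ℕ}

/-- The `i`-th component `θ_i + 2πn_i` of the wave vector of the `n`-th Bloch wave, where
`z_i = exp (iθ_i)` with `θ_i ∈ (-π, π]`. -/
def waveVector (z : Fin d → Circle) (n : Fin d → ℤ) (i : Fin d) : ℝ :=
  Complex.arg (z i) + 2 * Real.pi * n i

/-- The Bloch wave `u ↦ exp (i ∑ⱼ (θ_j + 2πn_j) u_j)`, which is `z`-periodic in every direction. -/
def blochWave (z : Fin d → Circle) (n : Fin d → ℤ) (u : Fin d → ℝ) : ℂ :=
  Complex.exp ((∑ j, waveVector z n j * u j : ℝ) * Complex.I)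

lemma norm_blochWave (z : Fin d → Circle) (n : Fin d → ℤ) (u : Fin d → ℝ) :
    ‖blochWave z n u‖ = 1 :=
  Complex.norm_exp_ofReal_mul_I _

lemma conj_blochWave_mul_self (z : Fin d → Circle) (n : Fin d → ℤ) (u : Fin d → ℝ) :
    conj (blochWave z n u) * blochWave z n u = 1 := by
  rw [RCLike.conj_mul, norm_blochWave]
  simp

lemma contDiff_blochWave (z : Fin d → Circle) (n : Fin d → ℤ) :
    ContDiff ℝ ∞ (blochWave z n) := by
  have h : ContDiff ℝ ∞ fun u : Fin d → ℝ => ∑ j, waveVector z n j * u j :=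
    ContDiff.sum fun j _ => (contDiff_apply ℝ ℝ j).const_smul (waveVector z n j)
  exact ((Complex.ofRealCLM.contDiff.comp h).mul contDiff_const).cexp

lemma classicalPartial_blochWave (z : Fin d → Circle) (n : Fin d → ℤ) (i : Fin d)
    (u : Fin d → ℝ) :
    classicalPartial i (blochWave z n) u = waveVector z n i * Complex.I * blochWave z n u := by
  have h1 : HasFDerivAt (fun u : Fin d → ℝ => ∑ j, waveVector z n j * u j)
      (∑ j, waveVector z n j • ContinuousLinearMap.proj (R := ℝ) (φ := fun _ : Fin d => ℝ) j) u :=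
    HasFDerivAt.fun_sum fun j _ => (hasFDerivAt_apply j u).const_mul _
  have h2 := ((Complex.ofRealCLM.hasFDerivAt.comp u h1).mul_const Complex.I).cexp
  have h3 := congrArg (fun L : (Fin d → ℝ) →L[ℝ] ℂ => L (Pi.single i 1)) h2.fderiv
  simp only [Function.comp_def, Complex.ofRealCLM_apply] at h3
  rw [classicalPartial]
  refine h3.trans ?_
  simp [sum_apply, Pi.single_apply, blochWave]
  ring

lemma isTest_blochWave (z : Fin d → Circle) (n : Fin d → ℤ) (i : Fin d) :
    IsTest z i (blochWave z n) := by
  refine ⟨contDiff_blochWave z n, fun u _ => ?_⟩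
  have hz : (z i : ℂ) = Complex.exp (waveVector z n i * Complex.I) := by
    have h1 : (waveVector z n i : ℂ) * Complex.I
        = Complex.arg (z i) * Complex.I + n i * (2 * Real.pi * Complex.I) := by
      simp only [waveVector]; push_cast; ring
    rw [h1, Complex.exp_add, Complex.exp_int_mul_two_pi_mul_I, mul_one]
    have := Complex.norm_mul_exp_arg_mul_I (z i : ℂ)
    rw [Circle.norm_coe, Complex.ofReal_one, one_mul] at this
    exact this.symm
  have hsum : ∑ j, waveVector z n j * Function.update u i 1 j
      = waveVector z n i + ∑ j, waveVector z n j * Function.update u i 0 j := by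
    rw [← Finset.add_sum_erase _ _ (Finset.mem_univ i),
      ← Finset.add_sum_erase _ (fun j => waveVector z n j * Function.update u i 0 j)
        (Finset.mem_univ i)]
    simp only [Function.update_self, mul_one, mul_zero, zero_add]
    congr 1
    refine Finset.sum_congr rfl fun j hj => ?_
    simp [Function.update_of_ne (Finset.ne_of_mem_erase hj)]
  rw [blochWave, blochWave, hsum, hz, ← Complex.exp_add]
  congr 1
  push_cast
  ring

lemma memLp_blochWave (z : Fin d → Circle) (n : Fin d → ℤ) :
    MemLp (blochWave z n) 2 (cubeMeasure d) :=
  memLp_of_continuous (contDiff_blochWave z n).continuous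

lemma blochWave_eq_mul_mFourier (z : Fin d → Circle) (n : Fin d → ℤ) (u : Fin d → ℝ) :
    blochWave z n u
      = blochWave z 0 u * UnitAddTorus.mFourier n (fun i => (u i : UnitAddCircle)) := by
  have h : UnitAddTorus.mFourier n (fun i => (u i : UnitAddCircle))
      = Complex.exp (∑ i, 2 * Real.pi * Complex.I * n i * u i) := by
    rw [Complex.exp_sum, UnitAddTorus.mFourier, ContinuousMap.coe_mk]
    refine Finset.prod_congr rfl fun i _ => ?_
    rw [fourier_coe_apply]
    simp
  rw [h, blochWave, blochWave, ← Complex.exp_add]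
  congr 1
  push_cast [waveVector]
  rw [Finset.sum_mul, Finset.sum_mul, ← Finset.sum_add_distrib]
  refine Finset.sum_congr rfl fun i _ => ?_
  simp
  ring

/-- The normalized Haar measure on `ℝ / ℤ`, the measure for which Mathlib's multivariate Fourier
basis is stated. -/
local instance : MeasureSpace UnitAddCircle := ⟨AddCircle.haarAddCircle⟩

/-- The section of the covering `ℝ^d → (ℝ/ℤ)^d` with values in the fundamental domain `(0,1]^d`. -/
def torusSection (d : ℕ) (x : UnitAddTorus (Fin d)) : Fin d → ℝ :=
  (UnitAddTorus.measurableEquivPiIoc (fun _ => (0 : ℝ)) x).1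

lemma coe_torusSection (x : UnitAddTorus (Fin d)) :
    (fun i => (torusSection d x i : UnitAddCircle)) = x :=
  (UnitAddTorus.measurableEquivPiIoc (fun _ => (0 : ℝ))).symm_apply_apply x

/-- The two fundamental domains `(0,1]^d` and `[0,1)^d` differ by a null set, so that the section
pushes the Haar measure of the torus forward to Lebesgue measure on the cube. -/
lemma measurePreserving_torusSection (d : ℕ) :
    MeasurePreserving (torusSection d) volume (cubeMeasure d) := by
  have h1 := UnitAddTorus.measurePreserving_equivPiIoc (fun _ : Fin d => (0 : ℝ))
  have hS : MeasurableSet {x : Fin d → ℝ | ∀ i, x i ∈ Set.Ioc (0 : ℝ) (0 + 1)} :=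
    MeasurableSet.univ_pi' fun _ => measurableSet_Ioc
  have h2 := measurePreserving_subtype_coe (μa := volume) hS
  have h3 := h2.comp h1
  have h4 : cubeMeasure d
      = volume.restrict {x : Fin d → ℝ | ∀ i, x i ∈ Set.Ioc (0 : ℝ) (0 + 1)} := by
    have hset : {x : Fin d → ℝ | ∀ i, x i ∈ Set.Ioc (0 : ℝ) (0 + 1)}
        = Set.univ.pi fun _ => Set.Ioc 0 1 := by
      ext x; simp
    rw [hset]
    exact Measure.restrict_congr_set
      ((Measure.univ_pi_Ico_ae_eq_Icc (μ := fun _ : Fin d => (volume : Measure ℝ))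
        (f := fun _ => 0) (g := fun _ => 1)).trans
      (Measure.univ_pi_Ioc_ae_eq_Icc (μ := fun _ : Fin d => (volume : Measure ℝ))
        (f := fun _ => 0) (g := fun _ => 1)).symm)
  rw [h4]
  exact h3

lemma integral_comp_torusSection {f : (Fin d → ℝ) → ℂ}
    (hf : AEStronglyMeasurable f (cubeMeasure d)) :
    ∫ x, f (torusSection d x) = ∫ u, f u ∂(cubeMeasure d) := by
  have h := measurePreserving_torusSection d
  rw [← h.map_eq] at hf ⊢
  exact (integral_map h.measurable.aemeasurable hf).symm

lemma pairing_toLp {φ : (Fin d → ℝ) → ℂ} (hφ : MemLp φ 2 (cubeMeasure d)) (g : L2Cube d) :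
    inner ℂ hφ.toLp g = pairing φ g := by
  rw [L2.inner_def]
  apply integral_congr_ae
  filter_upwards [hφ.coeFn_toLp] with u hu
  simp [hu, mul_comm]

lemma orthonormal_blochWave (z : Fin d → Circle) :
    Orthonormal ℂ fun n => (memLp_blochWave z n).toLp := by
  rw [orthonormal_iff_ite]
  intro m n
  have h1 := orthonormal_iff_ite.1 (UnitAddTorus.orthonormal_mFourier (d := Fin d)) m n
  rw [← h1, ContinuousMap.inner_toLp, pairing_toLp,
    pairing_congr (Filter.EventuallyEq.refl _ _) (memLp_blochWave z n).coeFn_toLp, pairing,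
    ← integral_comp_torusSection
      (integrable_conj_mul (memLp_blochWave z m) (memLp_blochWave z n)).aestronglyMeasurable]
  congr 1
  ext x
  rw [blochWave_eq_mul_mFourier z m, blochWave_eq_mul_mFourier z n, coe_torusSection, map_mul]
  linear_combination (conj (UnitAddTorus.mFourier m x) * UnitAddTorus.mFourier n x)
    * conj_blochWave_mul_self z 0 (torusSection d x)

/-- The Bloch waves are total in `L₂`: after multiplication by the conjugate of the zeroth wave,
their orthogonality relations become the vanishing of all Fourier coefficients on the torus. -/
lemma eq_zero_of_inner_blochWave (z : Fin d → Circle) (g : L2Cube d)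
    (hg : ∀ n, inner ℂ (memLp_blochWave z n).toLp g = 0) : g = 0 := by
  have hs := measurePreserving_torusSection d
  have hmem : MemLp (fun u => conj (blochWave z 0 u) * g u) 2 (cubeMeasure d) := by
    refine (Lp.memLp g).of_le
      (((memLp_blochWave z 0).star.aestronglyMeasurable).mul (Lp.aestronglyMeasurable g)) ?_
    refine Filter.Eventually.of_forall fun u => ?_
    simp [norm_blochWave]
  have hmemT := hmem.comp_measurePreserving hs
  have hzero : hmemT.toLp = 0 := by
    refine (UnitAddTorus.mFourierBasis (d := Fin d)).repr.injective ?_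
    ext n
    rw [UnitAddTorus.mFourierBasis_repr, UnitAddTorus.mFourierCoeff]
    simp only [map_zero, lp.coeFn_zero, Pi.zero_apply]
    have h2 : ∫ t, UnitAddTorus.mFourier (-n) t • hmemT.toLp _ t
        = ∫ t, (fun u => conj (blochWave z n u) * g u) (torusSection d t) := by
      apply integral_congr_ae
      filter_upwards [hmemT.coeFn_toLp] with x hx
      rw [hx, blochWave_eq_mul_mFourier z n, coe_torusSection, map_mul, UnitAddTorus.mFourier_neg]
      simp only [Function.comp_apply, smul_eq_mul]
      ring
    rw [h2, integral_comp_torusSection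
      (integrable_conj_mul (memLp_blochWave z n) (Lp.memLp g)).aestronglyMeasurable]
    rw [← hg n, pairing_toLp, pairing]
  have hae : ∀ᵐ u ∂(cubeMeasure d), conj (blochWave z 0 u) * g u = 0 := by
    have h4 : hmem.toLp = 0 := by
      refine (Lp.compMeasurePreservingₗᵢ ℂ (torusSection d) hs).injective ?_
      rw [map_zero, ← hzero]
      exact Lp.toLp_compMeasurePreserving hmem hs
    have h5 := Lp.eq_zero_iff_ae_eq_zero.1 h4
    filter_upwards [h5, hmem.coeFn_toLp] with u h6 h7
    rw [← h7, h6]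
    rfl
  refine Lp.eq_zero_iff_ae_eq_zero.2 ?_
  filter_upwards [hae] with u hu
  have hne : conj (blochWave z 0 u) ≠ 0 := by
    rw [← norm_ne_zero_iff]
    simp [norm_blochWave]
  exact (mul_eq_zero.1 hu).resolve_left hne

/-- The Hilbert basis of `L₂([0,1)^d)` formed by the Bloch waves. -/
def blochBasis (z : Fin d → Circle) : HilbertBasis (Fin d → ℤ) ℂ (L2Cube d) :=
  HilbertBasis.mkOfOrthogonalEqBot (orthonormal_blochWave z) <| by
    refine (Submodule.eq_bot_iff _).2 fun g hg => eq_zero_of_inner_blochWave z g fun n => ?_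
    exact Submodule.inner_right_of_mem_orthogonal
      (Submodule.subset_span (Set.mem_range_self n)) hg

lemma blochBasis_apply (z : Fin d → Circle) (n : Fin d → ℤ) :
    blochBasis z n = (memLp_blochWave z n).toLp := by
  rw [blochBasis, HilbertBasis.coe_mkOfOrthogonalEqBot]

/-- The Bloch basis diagonalizes `∂_i^z`, with eigenvalues `i (θ_i + 2πn_i)`. -/
lemma inner_blochBasis_of_mem_partialGraph (z : Fin d → Circle) (n : Fin d → ℤ) (i : Fin d)
    {p : L2Cube d × L2Cube d} (hp : p ∈ partialGraph z i) :
    inner ℂ (blochBasis z n) p.2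
      = waveVector z n i * Complex.I * inner ℂ (blochBasis z n) p.1 := by
  rw [blochBasis_apply, pairing_toLp, pairing_toLp, hp _ (isTest_blochWave z n i)]
  have h : pairing (classicalPartial i (blochWave z n)) p.1
      = -(waveVector z n i * Complex.I) * pairing (blochWave z n) p.1 := by
    rw [pairing, pairing, ← integral_const_mul]
    congr 1
    ext u
    rw [classicalPartial_blochWave]
    simp only [map_mul, Complex.conj_ofReal, Complex.conj_I]
    ring
  rw [h]
  ring

lemma finite_waveVector_le (z : Fin d → Circle) (M : ℝ) :
    {n : Fin d → ℤ | ∑ i, waveVector z n i ^ 2 ≤ M}.Finite := by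
  refine (Set.Finite.pi' fun _ : Fin d => Set.finite_Icc (-⌈|M| + 2⌉) ⌈|M| + 2⌉).subset
    fun n hn i => ?_
  have h1 : waveVector z n i ^ 2 ≤ |M| :=
    (Finset.single_le_sum (f := fun i => waveVector z n i ^ 2) (fun _ _ => sq_nonneg _)
      (Finset.mem_univ i)).trans (hn.trans (le_abs_self M))
  have h2 : |waveVector z n i| ≤ |M| + 1 := by
    rw [← sq_abs] at h1
    nlinarith [abs_nonneg (waveVector z n i), abs_nonneg M]
  have h3 := abs_le.1 h2
  have h4 := Complex.arg_le_pi (z i)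
  have h5 := Complex.neg_pi_lt_arg (z i)
  have hpi := Real.pi_gt_three
  have h6 : |(n i : ℝ)| ≤ |M| + 2 := by
    rw [waveVector] at h3
    refine abs_le.2 ⟨?_, ?_⟩ <;> nlinarith [abs_nonneg M]
  have h7 := abs_le.1 (h6.trans (Int.le_ceil _))
  exact ⟨by exact_mod_cast h7.1, by exact_mod_cast h7.2⟩

end

end PeriodicElliptic

/-! ### The form domain as a Hilbert space -/

namespace PeriodicElliptic

noncomputable section

variable {d : ℕ}

lemma isClosed_partialGraph (z : Fin d → Circle) (i : Fin d) :
    IsClosed (partialGraph z i : Set (L2Cube d × L2Cube d)) := by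
  have h : (partialGraph z i : Set (L2Cube d × L2Cube d)) = ⋂ (φ) (hφ : IsTest z i φ),
      {p | inner ℂ hφ.memLp.toLp p.2 = -inner ℂ (memLp_of_continuous
        (continuous_classicalPartial (i := i) hφ.smooth)).toLp p.1} := by
    ext p
    simp only [Set.mem_iInter, Set.mem_ofPred_eq, pairing_toLp]
    rfl
  rw [h]
  exact isClosed_iInter fun φ => isClosed_iInter fun hφ =>
    isClosed_eq (by fun_prop) (by fun_prop)

/-- The form domain `D(h_z)` with its graph inner product
`(φ, f) + ∑ᵢ (∂_i^z φ, ∂_i^z f)`, realized as the space of tuples `(f, ∂_1^z f, …, ∂_d^z f)`; the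
index `none` carries the function itself. -/
def sobolevSpace (z : Fin d → Circle) :
    Submodule ℂ (PiLp 2 fun _ : Option (Fin d) => L2Cube d) where
  carrier := {F | ∀ i, (F none, F (some i)) ∈ partialGraph z i}
  add_mem' hF hG i := (partialGraph z i).add_mem (hF i) (hG i)
  zero_mem' i := (partialGraph z i).zero_mem
  smul_mem' r _ hF i := (partialGraph z i).smul_mem r (hF i)

instance (z : Fin d → Circle) : CompleteSpace (sobolevSpace z) := by
  have h : IsClosed (sobolevSpace z : Set (PiLp 2 fun _ : Option (Fin d) => L2Cube d)) := by
    have : (sobolevSpace z : Set (PiLp 2 fun _ : Option (Fin d) => L2Cube d))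
        = ⋂ i, (fun F => (F none, F (some i))) ⁻¹' (partialGraph z i : Set _) := by
      ext F
      simp only [Set.mem_iInter]
      rfl
    rw [this]
    exact isClosed_iInter fun i => (isClosed_partialGraph z i).preimage (by fun_prop)
  exact h.completeSpace_coe

/-- The inclusion of the form domain into `L₂`. -/
def sobolevValue (z : Fin d → Circle) : sobolevSpace z →L[ℂ] L2Cube d :=
  PiLp.proj 2 (fun _ : Option (Fin d) => L2Cube d) none ∘L (sobolevSpace z).subtypeL

/-- The partial derivative `∂_i^z` as a bounded operator from the form domain to `L₂`. -/
def sobolevDeriv (z : Fin d → Circle) (i : Fin d) : sobolevSpace z →L[ℂ] L2Cube d :=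
  PiLp.proj 2 (fun _ : Option (Fin d) => L2Cube d) (some i) ∘L (sobolevSpace z).subtypeL

lemma sobolevDeriv_mem (z : Fin d → Circle) (i : Fin d) (F : sobolevSpace z) :
    (sobolevValue z F, sobolevDeriv z i F) ∈ partialGraph z i :=
  F.2 i

lemma sobolev_norm_sq (z : Fin d → Circle) (F : sobolevSpace z) :
    ‖F‖ ^ 2 = ‖sobolevValue z F‖ ^ 2 + ∑ i, ‖sobolevDeriv z i F‖ ^ 2 := by
  rw [Submodule.coe_norm, PiLp.norm_sq_eq_of_L2, Fintype.sum_option]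
  rfl

/-- The element of the form domain underlying an element of `sobolevSpace z`. -/
def toFormDomain {z : Fin d → Circle} (F : sobolevSpace z) : formDomain z :=
  ⟨sobolevValue z F, (Submodule.mem_iInf _).2 fun i => by
    have h := sobolevDeriv_mem z i F
    rw [← partialZ_graph] at h
    exact LinearPMap.mem_domain_of_mem_graph h⟩

lemma gradZ_mem_partialGraph (z : Fin d → Circle) (i : Fin d) (f : formDomain z) :
    ((f : L2Cube d), gradZ z i f) ∈ partialGraph z i := by
  rw [← partialZ_graph]
  exact (partialZ z i).mem_graph (Submodule.inclusion (iInf_le _ i) f)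

lemma gradZ_toFormDomain {z : Fin d → Circle} (i : Fin d) (F : sobolevSpace z) :
    gradZ z i (toFormDomain F) = sobolevDeriv z i F := by
  have h := (partialGraph z i).sub_mem (gradZ_mem_partialGraph z i (toFormDomain F))
    (sobolevDeriv_mem z i F)
  exact sub_eq_zero.1 (partialGraph_unique z i _ h (sub_self _))

lemma exists_toFormDomain_eq {z : Fin d → Circle} (f : formDomain z) :
    ∃ F : sobolevSpace z, toFormDomain F = f := by
  refine ⟨⟨WithLp.toLp 2 fun o => o.elim (f : L2Cube d) fun i => gradZ z i f, fun i => ?_⟩, ?_⟩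
  · exact gradZ_mem_partialGraph z i f
  · rfl

/-- Rellich's theorem for `z`-periodic functions: the weights `|θ + 2πn|²` of the Bloch basis tend
to infinity, and Bessel's inequality for the derivatives bounds the weighted coefficients. -/
theorem isCompactOperator_sobolevValue (z : Fin d → Circle) :
    IsCompactOperator (sobolevValue z) := by
  refine isCompactOperator_of_weighted_coeff (blochBasis z) (sobolevValue z)
    (fun n => ∑ i, waveVector z n i ^ 2) (finite_waveVector_le z) (fun F s => ?_)
    (fun n => Finset.sum_nonneg fun _ _ => sq_nonneg _)
  have h : ∀ n i, waveVector z n i ^ 2 * ‖inner ℂ (blochBasis z n) (sobolevValue z F)‖ ^ 2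
      = ‖inner ℂ (blochBasis z n) (sobolevDeriv z i F)‖ ^ 2 := by
    intro n i
    rw [inner_blochBasis_of_mem_partialGraph z n i (sobolevDeriv_mem z i F)]
    simp [mul_pow]
  simp only [Finset.sum_mul, h]
  rw [Finset.sum_comm, sobolev_norm_sq]
  have := Finset.sum_le_sum fun i (_ : i ∈ Finset.univ) =>
    (blochBasis z).orthonormal.sum_inner_products_le (s := s) (sobolevDeriv z i F)
  linarith [sq_nonneg ‖sobolevValue z F‖]

/-! ### The form as a bounded operator on the form domain -/

lemma memLp_top_cubeMeasure {b : (Fin d → ℝ) → ℂ} (hb : MemLp b ⊤ volume) :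
    MemLp b ⊤ (cubeMeasure d) :=
  hb.restrict (cube d)

/-- Multiplication by a bounded function as a bounded operator on `L₂`. -/
def mulCLM (b : (Fin d → ℝ) → ℂ) (hb : MemLp b ⊤ volume) : L2Cube d →L[ℂ] L2Cube d :=
  (ContinuousLinearMap.mul ℂ ℂ).holderL (cubeMeasure d) ⊤ 2 2 (memLp_top_cubeMeasure hb).toLp

lemma coeFn_mulCLM {b : (Fin d → ℝ) → ℂ} (hb : MemLp b ⊤ volume) (f : L2Cube d) :
    mulCLM b hb f =ᵐ[cubeMeasure d] fun u => b u * f u := by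
  refine (ContinuousLinearMap.coeFn_holder _ _ _).trans ?_
  filter_upwards [(memLp_top_cubeMeasure hb).coeFn_toLp] with u hu
  rw [ContinuousLinearMap.mul_apply', hu]

lemma inner_eq_pairing (f g : L2Cube d) : inner ℂ f g = pairing f g := by
  rw [← pairing_toLp (Lp.memLp f), Lp.toLp_coeFn]

lemma inner_mulCLM {b : (Fin d → ℝ) → ℂ} (hb : MemLp b ⊤ volume) (k f : L2Cube d) :
    inner ℂ k (mulCLM b hb f) = pairing k (fun u => b u * f u) := by
  rw [inner_eq_pairing]
  exact pairing_congr (Filter.EventuallyEq.refl _ _) (coeFn_mulCLM hb f)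

lemma pairing_conj_mul (b f g : (Fin d → ℝ) → ℂ) :
    pairing (fun u => conj (b u) * f u) g = pairing f (fun u => b u * g u) := by
  rw [pairing, pairing]
  congr 1
  ext u
  simp only [map_mul, Complex.conj_conj]
  ring

namespace Coefficients

/-- The form `h_z` in terms of bounded operators from the form domain to `L₂`. -/
lemma form_toFormDomain (a : Coefficients d) {z : Fin d → Circle} (Φ F : sobolevSpace z) :
    a.form z (toFormDomain Φ) (toFormDomain F)
      = ∑ i, ∑ j, inner ℂ (sobolevDeriv z i Φ)
          (mulCLM (fun x => a.C x i j) (a.memLp_C i j) (sobolevDeriv z j F))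
        + ∑ i, (inner ℂ (sobolevValue z Φ) (mulCLM (a.c i) (a.memLp_c i) (sobolevDeriv z i F))
          + inner ℂ (sobolevDeriv z i Φ) (mulCLM (a.c' i) (a.memLp_c' i) (sobolevValue z F)))
        + inner ℂ (sobolevValue z Φ) (mulCLM a.c₀ a.memLp_c₀ (sobolevValue z F)) := by
  simp only [form, gradZ_toFormDomain, inner_mulCLM, pairing_conj_mul]
  rfl

/-- The bounded operator on the form domain that represents `h_z` with respect to the graph inner
product. -/
def formOperator (a : Coefficients d) (z : Fin d → Circle) :
    sobolevSpace z →L[ℂ] sobolevSpace z :=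
  ∑ i, ∑ j, (sobolevDeriv z i).adjoint ∘L
      mulCLM (fun x => a.C x i j) (a.memLp_C i j) ∘L sobolevDeriv z j
    + ∑ i, ((sobolevValue z).adjoint ∘L mulCLM (a.c i) (a.memLp_c i) ∘L sobolevDeriv z i
      + (sobolevDeriv z i).adjoint ∘L mulCLM (a.c' i) (a.memLp_c' i) ∘L sobolevValue z)
    + (sobolevValue z).adjoint ∘L mulCLM a.c₀ a.memLp_c₀ ∘L sobolevValue z

lemma inner_formOperator (a : Coefficients d) {z : Fin d → Circle} (Φ F : sobolevSpace z) :
    inner ℂ Φ (a.formOperator z F) = a.form z (toFormDomain Φ) (toFormDomain F) := by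
  rw [form_toFormDomain]
  simp only [formOperator, add_apply, sum_apply,
    ContinuousLinearMap.comp_apply, inner_add_right, inner_sum,
    ContinuousLinearMap.adjoint_inner_right]

/-- Uniform ellipticity, integrated over the cube against a vector of `L₂` functions. -/
lemma le_re_principal_part (a : Coefficients d) {lam : ℝ}
    (hlam : ∀ᵐ x, ∀ ξ : Fin d → ℂ,
      lam * ∑ i, ‖ξ i‖ ^ 2 ≤ (∑ i, ∑ j, conj (ξ i) * a.C x i j * ξ j).re)
    (g : Fin d → L2Cube d) :
    lam * ∑ i, ‖g i‖ ^ 2 ≤ (∑ i, ∑ j, inner ℂ (g i)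
      (mulCLM (fun x => a.C x i j) (a.memLp_C i j) (g j))).re := by
  have hint : ∀ i j, Integrable (fun u => conj (g i u) * (a.C u i j * g j u)) (cubeMeasure d) :=
    fun i j => integrable_conj_mul (Lp.memLp _) (memLp_mul (a.memLp_C i j) _)
  have hint0 : ∀ i, Integrable (fun u => conj (g i u) * g i u) (cubeMeasure d) :=
    fun i => integrable_conj_mul (Lp.memLp _) (Lp.memLp _)
  have hnorm : ∀ i, ‖g i‖ ^ 2 = ∫ u, ‖g i u‖ ^ 2 ∂(cubeMeasure d) := by
    intro i
    have h := inner_self_eq_norm_sq (𝕜 := ℂ) (g i)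
    rw [inner_eq_pairing, pairing, ← integral_re (hint0 i)] at h
    rw [← h]
    congr 1
    ext u
    rw [RCLike.conj_mul, ← RCLike.ofReal_pow, RCLike.ofReal_re]
  have hsq : ∀ i, Integrable (fun u => ‖g i u‖ ^ 2) (cubeMeasure d) :=
    fun i => (Lp.memLp (g i)).integrable_norm_pow (by norm_num)
  have hR : ∑ i, ∑ j, inner ℂ (g i) (mulCLM (fun x => a.C x i j) (a.memLp_C i j) (g j))
      = ∫ u, ∑ i, ∑ j, conj (g i u) * (a.C u i j * g j u) ∂(cubeMeasure d) := by
    rw [integral_finsetSum _ fun i _ => integrable_finsetSum _ fun j _ => hint i j]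
    refine Finset.sum_congr rfl fun i _ => ?_
    rw [integral_finsetSum _ fun j _ => hint i j]
    refine Finset.sum_congr rfl fun j _ => ?_
    rw [inner_mulCLM, pairing]
  simp only [hnorm]
  rw [hR, ← integral_finsetSum _ fun i _ => hsq i, ← integral_const_mul]
  have hre := integral_re (𝕜 := ℂ) (integrable_finsetSum Finset.univ fun i _ =>
    integrable_finsetSum Finset.univ fun j _ => hint i j)
  refine le_of_le_of_eq ?_ hre
  refine integral_mono_ae ((integrable_finsetSum _ fun i _ => hsq i).const_mul _)
    (integrable_finsetSum Finset.univ fun i _ =>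
      integrable_finsetSum Finset.univ fun j _ => hint i j).re ?_
  filter_upwards [ae_restrict_of_ae hlam] with u hu
  refine (hu fun i => g i u).trans_eq ?_
  simp only [mul_assoc]
  rfl

/-- Gårding's inequality: half of the ellipticity constant absorbs the first-order terms. -/
lemma exists_le_re_form (a : Coefficients d) (z : Fin d → Circle) :
    ∃ c K : ℝ, 0 < c ∧ ∀ F : sobolevSpace z,
      c * ∑ i, ‖sobolevDeriv z i F‖ ^ 2 - K * ‖sobolevValue z F‖ ^ 2
        ≤ (a.form z (toFormDomain F) (toFormDomain F)).re := by
  obtain ⟨lam, hlam, hell⟩ := a.elliptic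
  set m : Fin d → ℝ := fun i => ‖mulCLM (a.c i) (a.memLp_c i)‖ + ‖mulCLM (a.c' i) (a.memLp_c' i)‖
  set m₀ : ℝ := ‖mulCLM a.c₀ a.memLp_c₀‖
  refine ⟨lam / 2, ∑ i, m i ^ 2 / (2 * lam) + m₀, by positivity, fun F => ?_⟩
  set f := sobolevValue z F
  set g : Fin d → L2Cube d := fun i => sobolevDeriv z i F
  have hinner : ∀ (T : L2Cube d →L[ℂ] L2Cube d) (x y : L2Cube d),
      -(‖T‖ * ‖x‖ * ‖y‖) ≤ (inner ℂ x (T y)).re := by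
    intro T x y
    have h1 : |(inner ℂ x (T y)).re| ≤ ‖x‖ * (‖T‖ * ‖y‖) :=
      (Complex.abs_re_le_norm _).trans ((norm_inner_le_norm _ _).trans
        (mul_le_mul_of_nonneg_left (T.le_opNorm y) (norm_nonneg _)))
    linarith [(abs_le.1 h1).1]
  have h0 := a.le_re_principal_part hell g
  have h1 : ∀ i, -(lam / 2 * ‖g i‖ ^ 2 + m i ^ 2 / (2 * lam) * ‖f‖ ^ 2)
      ≤ (inner ℂ f (mulCLM (a.c i) (a.memLp_c i) (g i))
          + inner ℂ (g i) (mulCLM (a.c' i) (a.memLp_c' i) f)).re := by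
    intro i
    have h2 := hinner (mulCLM (a.c i) (a.memLp_c i)) f (g i)
    have h3 := hinner (mulCLM (a.c' i) (a.memLp_c' i)) (g i) f
    -- Young's inequality with the weight that leaves half of the ellipticity constant
    have h4 : m i * ‖f‖ * ‖g i‖ ≤ lam / 2 * ‖g i‖ ^ 2 + m i ^ 2 / (2 * lam) * ‖f‖ ^ 2 := by
      have h5 : lam / 2 * ‖g i‖ ^ 2 + m i ^ 2 / (2 * lam) * ‖f‖ ^ 2 - m i * ‖f‖ * ‖g i‖
          = (lam * ‖g i‖ - m i * ‖f‖) ^ 2 / (2 * lam) := by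
        field_simp
        ring
      have h6 : 0 ≤ (lam * ‖g i‖ - m i * ‖f‖) ^ 2 / (2 * lam) := by positivity
      linarith
    have h7 : m i * ‖f‖ * ‖g i‖ = ‖mulCLM (a.c i) (a.memLp_c i)‖ * ‖f‖ * ‖g i‖
        + ‖mulCLM (a.c' i) (a.memLp_c' i)‖ * ‖g i‖ * ‖f‖ := by
      simp only [m]
      ring
    rw [Complex.add_re]
    linarith
  have h8 := Finset.sum_le_sum fun i (_ : i ∈ Finset.univ) => h1 i
  rw [Finset.sum_neg_distrib, Finset.sum_add_distrib, ← Finset.mul_sum, ← Finset.sum_mul,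
    ← Complex.re_sum] at h8
  have h9 := hinner (mulCLM a.c₀ a.memLp_c₀) f f
  rw [form_toFormDomain, Complex.add_re, Complex.add_re]
  change lam / 2 * ∑ i, ‖g i‖ ^ 2 - _ * ‖f‖ ^ 2 ≤ _
  nlinarith

/-! ### The resolvent -/

/-- Lower bounds `c y - K x` and `-μ x` for `q` combine into coercivity of `q + r x` for `r > μ`. -/
lemma exists_pos_mul_add_le {c K μ r : ℝ} (hc : 0 < c) (hr : μ < r) :
    ∃ e : ℝ, 0 < e ∧ ∀ q x y : ℝ, 0 ≤ x → 0 ≤ y → c * y - K * x ≤ q → -μ * x ≤ q →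
      e * (x + y) ≤ q + r * x := by
  set δ := r - μ with hδ
  have hδpos : 0 < δ := sub_pos.2 hr
  -- Take the convex combination of the two bounds in which the first has a weight `t` so small that
  -- at least half of `δ` remains as the coefficient of `x`.
  set t : ℝ := δ / (2 * (δ + |K - μ| + c)) with ht
  have hden : 0 < 2 * (δ + |K - μ| + c) := by positivity
  have htpos : 0 < t := by positivity
  have ht1 : t ≤ 1 := by
    rw [ht, div_le_one hden]
    linarith [abs_nonneg (K - μ)]
  have htK : t * (K - μ) ≤ δ / 2 := by
    have h1 : t * (2 * (δ + |K - μ| + c)) = δ := div_mul_cancel₀ _ hden.ne'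
    have h2 : t * (K - μ) ≤ t * (δ + |K - μ| + c) :=
      mul_le_mul_of_nonneg_left (by linarith [le_abs_self (K - μ)]) htpos.le
    linarith
  refine ⟨min (t * c) (δ / 2), by positivity, fun q x y hx hy h1 h2 => ?_⟩
  have h3 := mul_le_mul_of_nonneg_left h1 htpos.le
  have h4 := mul_le_mul_of_nonneg_left h2 (sub_nonneg.2 ht1)
  have h5 := mul_le_mul_of_nonneg_right (min_le_left (t * c) (δ / 2)) hy
  have h6 := mul_le_mul_of_nonneg_right (min_le_right (t * c) (δ / 2)) hx
  have h7 := mul_le_mul_of_nonneg_right htK hx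
  have h8 : r = δ + μ := by rw [hδ]; ring
  rw [h8]
  linarith

/-- A lower bound of the form and Gårding's inequality together make `λ + h_z` coercive on the form
domain when `Re λ` exceeds the negative of the bound. -/
lemma exists_coercive (a : Coefficients d) (z : Fin d → Circle) {μ : ℝ}
    (hμ : ∀ f : formDomain z, -μ * ‖(f : L2Cube d)‖ ^ 2 ≤ (a.form z f f).re) {lam : ℂ}
    (hlam : μ < lam.re) :
    ∃ c : ℝ, 0 < c ∧ ∀ F : sobolevSpace z, c * ‖F‖ ^ 2
      ≤ (a.form z (toFormDomain F) (toFormDomain F)).re + lam.re * ‖sobolevValue z F‖ ^ 2 := by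
  obtain ⟨c, K, hc, hK⟩ := a.exists_le_re_form z
  obtain ⟨e, he, hbound⟩ := exists_pos_mul_add_le (K := K) hc hlam
  refine ⟨e, he, fun F => ?_⟩
  have h2 : -μ * ‖sobolevValue z F‖ ^ 2 ≤ (a.form z (toFormDomain F) (toFormDomain F)).re :=
    hμ (toFormDomain F)
  rw [sobolev_norm_sq]
  exact hbound _ _ _ (by positivity) (by positivity) (hK F) h2

/-- To the right of the abscissa given by a lower bound of the form, the resolvent of `H_z` exists
and factors through the compact inclusion of the form domain. -/
theorem exists_isResolvent_isCompactOperator (a : Coefficients d) (z : Fin d → Circle) {μ : ℝ}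
    (hμ : ∀ f : formDomain z, -μ * ‖(f : L2Cube d)‖ ^ 2 ≤ (a.form z f f).re) {lam : ℂ}
    (hlam : μ < lam.re) :
    ∃ R : L2Cube d →L[ℂ] L2Cube d,
      IsResolvent (a.operator z) lam R ∧ IsCompactOperator R := by
  obtain ⟨c, hc, hcoer⟩ := a.exists_coercive z hμ hlam
  set J := sobolevValue z with hJ
  set B : sobolevSpace z →L[ℂ] sobolevSpace z := a.formOperator z + lam • (J.adjoint ∘L J) with hB
  have hinner : ∀ Φ F, inner ℂ Φ (B F)
      = a.form z (toFormDomain Φ) (toFormDomain F) + lam * inner ℂ (J Φ) (J F) := by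
    intro Φ F
    rw [hB, add_apply, inner_add_right, inner_formOperator, smul_apply,
      inner_smul_right, ContinuousLinearMap.comp_apply, ContinuousLinearMap.adjoint_inner_right]
  have hbij : Function.Bijective B := by
    refine B.bijective_of_coercive hc fun F => (hcoer F).trans_eq ?_
    rw [hinner, inner_self_eq_norm_sq_to_K]
    simp [← Complex.ofReal_pow]
  set E : sobolevSpace z ≃L[ℂ] sobolevSpace z := ContinuousLinearEquiv.ofBijective B
    (LinearMap.ker_eq_bot.2 hbij.1) (LinearMap.range_eq_top.2 hbij.2) with hE
  have hEB : ∀ F, E F = B F := fun F => rfl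
  refine ⟨J ∘L (E.symm : sobolevSpace z →L[ℂ] sobolevSpace z) ∘L J.adjoint, ⟨?_, ?_⟩,
    (isCompactOperator_sobolevValue z).comp_clm
      ((E.symm : sobolevSpace z →L[ℂ] sobolevSpace z) ∘L J.adjoint)⟩
  · intro g
    set F := E.symm (J.adjoint g) with hF
    have hBF : B F = J.adjoint g := by rw [← hEB, hF, E.apply_symm_apply]
    have hgraph : (J F, g - lam • J F) ∈ (a.operator z).graph := by
      rw [a.operator_graph]
      refine ⟨(toFormDomain F).2, fun φ => ?_⟩
      obtain ⟨Φ, rfl⟩ := exists_toFormDomain_eq φ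
      have h := hinner Φ F
      rw [hBF, ContinuousLinearMap.adjoint_inner_right] at h
      change a.form z (toFormDomain Φ) (toFormDomain F) = inner ℂ (J Φ) (g - lam • J F)
      rw [inner_sub_right, inner_smul_right, h]
      ring
    obtain ⟨y, hy1, hy2⟩ := (LinearPMap.mem_graph_iff _).1 hgraph
    simp only at hy1 hy2
    have hdom : J F ∈ (a.operator z).domain := hy1 ▸ y.2
    refine ⟨hdom, ?_⟩
    obtain rfl : y = ⟨J F, hdom⟩ := Subtype.ext hy1
    change lam • J F + a.operator z ⟨J F, hdom⟩ = g
    rw [hy2]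
    abel
  · intro f
    have hgraph := (a.operator z).mem_graph f
    rw [a.operator_graph] at hgraph
    obtain ⟨hf, hform⟩ := hgraph
    obtain ⟨F, hF⟩ := exists_toFormDomain_eq (⟨f, hf⟩ : formDomain z)
    have hJF : J F = f := congrArg Subtype.val hF
    have hBF : B F = J.adjoint (lam • (f : L2Cube d) + a.operator z f) := by
      refine ext_inner_left ℂ fun Φ => ?_
      rw [hinner, hF, ContinuousLinearMap.adjoint_inner_right, inner_add_right, inner_smul_right,
        hJF, add_comm]
      congr 1
      exact hform (toFormDomain Φ)
    change J (E.symm (J.adjoint _)) = _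
    rw [← hBF, ← hEB, E.symm_apply_apply, hJF]

end Coefficients

end

/-- If one resolvent is compact then all are, by the resolvent identity
`R' = R (1 + (λ - λ') R')`. -/
theorem IsResolvent.isCompactOperator {E : Type*} [NormedAddCommGroup E] [NormedSpace ℂ E]
    {T : E →ₗ.[ℂ] E} {lam lam' : ℂ} {R R' : E →L[ℂ] E} (h : IsResolvent T lam R)
    (hR : IsCompactOperator R) (h' : IsResolvent T lam' R') : IsCompactOperator R' := by
  have hid : R' = R ∘L (ContinuousLinearMap.id ℂ E + (lam - lam') • R') := by
    ext g
    obtain ⟨hg, hgeq⟩ := h'.1 g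
    have h1 := h.2 ⟨R' g, hg⟩
    have h2 : lam • R' g + T ⟨R' g, hg⟩ = g + (lam - lam') • R' g := by
      rw [sub_smul]
      nth_rewrite 3 [← hgeq]
      abel
    simp only [h2] at h1
    simpa using h1.symm
  rw [hid]
  exact hR.comp_clm (ContinuousLinearMap.id ℂ E + (lam - lam') • R')

end PeriodicElliptic

theorem lemma2p0 {d : ℕ} (a : PeriodicElliptic.Coefficients d) (z : Fin d → Circle) :
    PeriodicElliptic.HasCompactResolvent (a.operator z) ∧
      ∀ μ : ℝ,
        (∀ f : PeriodicElliptic.formDomain z,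
          -μ * ‖(f : PeriodicElliptic.L2Cube d)‖ ^ 2 ≤ (a.form z f f).re) →
        ∀ lam : ℂ, μ < lam.re →
          ∃ R : PeriodicElliptic.L2Cube d →L[ℂ] PeriodicElliptic.L2Cube d,
            PeriodicElliptic.IsResolvent (a.operator z) lam R ∧ IsCompactOperator R := by
  refine ⟨?_, fun μ hμ lam hlam => a.exists_isResolvent_isCompactOperator z hμ hlam⟩
  obtain ⟨c, K, hc, hK⟩ := a.exists_le_re_form z
  have hbound : ∀ f : PeriodicElliptic.formDomain z,
      -K * ‖(f : PeriodicElliptic.L2Cube d)‖ ^ 2 ≤ (a.form z f f).re := by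
    intro f
    obtain ⟨F, rfl⟩ := PeriodicElliptic.exists_toFormDomain_eq f
    have h1 := hK F
    have h2 : 0 ≤ c * ∑ i, ‖PeriodicElliptic.sobolevDeriv z i F‖ ^ 2 := by positivity
    change -K * ‖PeriodicElliptic.sobolevValue z F‖ ^ 2 ≤ _
    linarith
  obtain ⟨R, hR, hRc⟩ := a.exists_isResolvent_isCompactOperator z hbound
    (lam := ((K + 1 : ℝ) : ℂ)) (by simp)
  exact ⟨⟨_, R, hR⟩, fun lam' R' h' => hR.isCompactOperator hRc h'⟩
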